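/- Let $d\ge 2$, $H\ge 1$, $\epsilon>0$, and let $\phi:\mathcal S\times\mathcal A\to\mathbb R^d$ be a (measurable) feature map with $\|\phi(s,a)\|_2\le 1$. *Linear MDPs.* A linear MDP with feature map $\phi$ and horizon $H$ has a fixed initial state $s_1$ and transition kernels $P_h(B\mid s,a)=\langle\phi(s,a),\mu_h(B)\rangle$, $h\in[H]$, where $\mu_h$ is a vector of $d$ signed measures on $\mathcal S$ with $\|\mu_h(\mathcal S)\|_2\le\sqrt d$. Policies may be randomized and history-dependent. $\mathbb E_\pi\phi_h\phi_h^\top$ is the expectation of $\phi(s_h,a_h)\phi(s_h,a_h)^\top$ when $\pi$ is run, and $\lambda_{\min}$ is the smallest eigenvalue. *Explorative policies.* Let $\mathcal W$ be a finite $\frac{\epsilon}{2H}$-cover of the Euclidean ball of radius $2H\sqrt d$ in $\mathbb R^d$, and let $\mathcal R_\epsilon$ be a finite $\frac{\epsilon}{2H}$-cover, in supremum norm, of the set of all functions $r(s,a)=\sqrt{\phi(s,a)^\top(I+\Sigma)^{-1}\phi(s,a)}$ with $\Sigma\succeq 0$. For every $h\in[H]$ let $\Pi_{h,\epsilon}$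 be the set of deterministic (measurable) decision rules $s\mapsto\arg\max_a r(s,a)$, $r\in\mathcal R_\epsilon$, and $s\mapsto\arg\max_a\phi(s,a)^\top w$, $w\in\mathcal W$, one for each $r$ and each $w$, with ties broken arbitrarily. Put $\Pi^{exp}_\epsilon=\Pi_{1,\epsilon}\times\cdots\times\Pi_{H,\epsilon}$, and let $\Delta(\Pi^{exp}_\epsilon)$ be the set of mixtures of policies from $\Pi^{exp}_\epsilon$. Then the following hold. 1. For every such $\Pi^{exp}_\epsilon$, every linear MDP with feature map $\phi$ and horizon $H$, and every $\lambda^\star$: if $\sup_\pi\lambda_{\min}(\mathbb E_\pi\phi_h\phi_h^\top)\ge\lambda^\star$ for all $h\in[H]$, the supremum being over all policies, and $\epsilon\le\lambda^\star/4$, then for every $h\in[H]$ there is $\pi\in\Delta(\Pi^{exp}_\epsilon)$ with $$\lambda_{\min}(\mathbb E_\pi\phi_h\phi_h^\top)\ge\frac{(\lambda^\star)^2}{64\,d\log(1/\lambda^\star)}.$$ 2. If $\epsilon\le 1$, $\log|\mathcal W|\le d\log\bigl(1+\frac{8H^2\sqrt d}{\epsilon}\bigr)$ and $\log|\mathcal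 R_\epsilon|\le d^2\log\bigl(1+\frac{32H^2\sqrt d}{\epsilon^2}\bigr)$, then for every $h\in[H]$ $$\log|\Pi_{h,\epsilon}|\le 2d^2\log\Bigl(1+\frac{32H^2\sqrt d}{\epsilon^2}\Bigr).$$ 3. The construction can be carried out with covers of the sizes in 2, provided that (measurable) argmax rules exist for all functions $\phi^\top w$, $w\in\mathbb R^d$, and $\sqrt{\phi^\top(I+\Sigma)^{-1}\phi}$, $\Sigma\succeq0$. -/

import Mathlib

open MeasureTheory ProbabilityTheory

open scoped Matrix

noncomputable section

namespace LinMDP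

variable {S A : Type*} [MeasurableSpace S] [MeasurableSpace A] {d H : ℕ}

/-- Transition part of a linear MDP with horizon `H`, fixed initial state and feature map `φ`:
`P h (B | s, a) = ⟨φ (s, a), μ h B⟩`, where `μ h` is a vector of `d` signed measures on the state
space with `‖μ h S‖₂ ≤ √d`. Layers are numbered `0, …, H - 1`. -/
structure LinearMDP (φ : S × A → EuclideanSpace ℝ (Fin d)) (H : ℕ) where
  init : S
  P : Fin H → Kernel (S × A) S
  markov : ∀ h, IsMarkovKernel (P h)
  μ : Fin H → Fin d → SignedMeasure S
  linear : ∀ (h : Fin H) (x : S × A) (B : Set S), MeasurableSet B →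
    (P h x).real B = ∑ i, φ x i * μ h i B
  mass_le : ∀ h : Fin H, ‖WithLp.toLp 2 (fun i => μ h i Set.univ)‖ ≤ √(d : ℝ)

variable (S A H) in
/-- A randomized policy, which may depend on the whole history: at layer `h` the action is drawn
from a distribution depending on the earlier state-action pairs and the current state.
Markov policies are those that ignore the earlier pairs. -/
structure Policy where
  act : ∀ h : Fin H, Kernel ((Fin h → S × A) × S) A
  markov : ∀ h, IsMarkovKernel (act h)

variable (S A) in
/-- A deterministic Markov decision rule for one layer. -/
abbrev DetRule := {f : S → A // Measurable f}

/-- The deterministic Markov policy that uses the rule `f h` at layer `h`. -/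
def Policy.ofRules (f : Fin H → DetRule S A) : Policy S A H where
  act h := Kernel.deterministic (fun z => (f h).1 z.2) ((f h).2.comp measurable_snd)
  markov _ := inferInstance

/-- Joint law of `((s₀, a₀), …, (s_{n-1}, a_{n-1}))` and `s_n` when `π` is run in `M`. -/
def histLaw {φ : S × A → EuclideanSpace ℝ (Fin d)} (M : LinearMDP φ H) (π : Policy S A H) :
    (n : ℕ) → n < H → Measure ((Fin n → S × A) × S)
  | 0, _ => Measure.dirac (Fin.elim0, M.init)
  | n + 1, hn =>
    ((histLaw M π n (Nat.lt_of_succ_lt hn) ⊗ₘ π.act ⟨n, Nat.lt_of_succ_lt hn⟩) ⊗ₘ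
        (M.P ⟨n, Nat.lt_of_succ_lt hn⟩).comap
          (fun z : ((Fin n → S × A) × S) × A => (z.1.2, z.2)) (by fun_prop)).map
      (fun z => (Fin.snoc (α := fun _ => S × A) z.1.1.1 (z.1.1.2, z.1.2), z.2))

/-- Law of `(s_h, a_h)` when `π` is run in `M`. -/
def occ {φ : S × A → EuclideanSpace ℝ (Fin d)} (M : LinearMDP φ H) (π : Policy S A H)
    (h : Fin H) : Measure (S × A) :=
  (histLaw M π h h.2 ⊗ₘ π.act h).map (fun z => (z.1.2, z.2))

/-- The covariance matrix `𝔼 [φ φᵀ]` of the features under a law `ν` of `(s, a)`. -/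
def cov (φ : S × A → EuclideanSpace ℝ (Fin d)) (ν : Measure (S × A)) :
    Matrix (Fin d) (Fin d) ℝ :=
  Matrix.of fun i j => ∫ x, φ x i * φ x j ∂ν

/-- The smallest eigenvalue (of a symmetric matrix of positive size). -/
def lambdaMin (X : Matrix (Fin d) (Fin d) ℝ) : ℝ := sInf (spectrum ℝ X)

/-- The reward `r(s, a) = √(φ(s, a)ᵀ (I + Σ)⁻¹ φ(s, a))`. -/
def explReward (φ : S × A → EuclideanSpace ℝ (Fin d)) (X : Matrix (Fin d) (Fin d) ℝ)
    (x : S × A) : ℝ :=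
  √((φ x).ofLp ⬝ᵥ ((1 + X)⁻¹ *ᵥ (φ x).ofLp))

/-- The linear function `(s, a) ↦ φ(s, a)ᵀ w`. -/
def linFun (φ : S × A → EuclideanSpace ℝ (Fin d)) (w : EuclideanSpace ℝ (Fin d))
    (x : S × A) : ℝ :=
  inner ℝ (φ x) w

/-- `f s ∈ argmax_a r(s, a)` for every state `s`. -/
def IsGreedy (r : S × A → ℝ) (f : DetRule S A) : Prop :=
  ∀ s a, r (s, a) ≤ r (s, f.1 s)

/-- The choices made in the construction of the explorative policy set: an `ε/(2H)`-cover `W` of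
the Euclidean ball of radius `2H√d`, an `ε/(2H)`-cover `R` in supremum norm of the rewards
`explReward φ X` with `X` positive semidefinite, and, for every layer, greedy rules for the
functions `φᵀ w`, `w ∈ W`, and for the functions in `R` (ties are broken in any way). -/
structure ExpConstruction (φ : S × A → EuclideanSpace ℝ (Fin d)) (H : ℕ) (ε : ℝ) where
  W : Finset (EuclideanSpace ℝ (Fin d))
  R : Finset (S × A → ℝ)
  W_cover : ∀ v : EuclideanSpace ℝ (Fin d), ‖v‖ ≤ 2 * H * √(d : ℝ) →
    ∃ w ∈ W, ‖v - w‖ ≤ ε / (2 * H)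
  R_cover : ∀ X : Matrix (Fin d) (Fin d) ℝ, X.PosSemidef →
    ∃ r ∈ R, ∀ x, |explReward φ X x - r x| ≤ ε / (2 * H)
  ruleW : Fin H → EuclideanSpace ℝ (Fin d) → DetRule S A
  ruleR : Fin H → (S × A → ℝ) → DetRule S A
  ruleW_greedy : ∀ h, ∀ w ∈ W, IsGreedy (linFun φ w) (ruleW h w)
  ruleR_greedy : ∀ h, ∀ r ∈ R, IsGreedy r (ruleR h r)

namespace ExpConstruction

variable {φ : S × A → EuclideanSpace ℝ (Fin d)} {ε : ℝ}

/-- The two covers have the cardinalities prescribed in the construction. -/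
def IsSmall (C : ExpConstruction φ H ε) : Prop :=
  Real.log C.W.card ≤ d * Real.log (1 + 8 * H ^ 2 * √(d : ℝ) / ε) ∧
  Real.log C.R.card ≤ d ^ 2 * Real.log (1 + 32 * H ^ 2 * √(d : ℝ) / ε ^ 2)

open Classical in
/-- The explorative decision rules for layer `h`. -/
def layer (C : ExpConstruction φ H ε) (h : Fin H) : Finset (DetRule S A) :=
  C.R.image (C.ruleR h) ∪ C.W.image (C.ruleW h)

/-- The explorative policy set: the product of the sets for the individual layers. -/
def policies (C : ExpConstruction φ H ε) : Finset (Fin H → DetRule S A) :=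
  Fintype.piFinset C.layer

/-- Law of `(s_h, a_h)` under the mixture that draws a policy of the explorative set from `p` and
then runs it in `M`. -/
def mixOcc (C : ExpConstruction φ H ε) (M : LinearMDP φ H) (p : PMF C.policies) (h : Fin H) :
    Measure (S × A) :=
  ∑ f, p f • occ M (Policy.ofRules f.1) h

end ExpConstruction

end LinMDP

end

/-! ### Spectral bounds, weighted Cauchy-Schwarz and the derivative of the determinant. -/

open MeasureTheory ProbabilityTheory

open scoped Matrix

noncomputable section

/-! Fix a layer h, write λ for λ*, and put T = 64 d log(1/λ) / λ². Among the mixtures of explorative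
policies take one maximizing det(I + TΛ), where Λ is its covariance at layer h, and let X = TΛ.
First-order optimality (Kiefer-Wolfowitz, `Matrix.exists_stdSimplex_mul_trace_le`) gives T ·
E_f[φᵀ(I+X)⁻¹φ] ≤ d for every explorative f. By Jensen, each f then collects at most λ/6 of the
reward r = √(φᵀ(I+X)⁻¹φ).

This forces vᵀXv ≥ 1 for every unit v (`one_le_dotProduct_mulVec`), hence λ_min(Λ) ≥ 1/T, which is
the claim. Otherwise (v·φ)² ≤ (3/2) r pointwise; some policies excite v by nearly λ, so the optimal
value of r is at least 2λ/3. Approximate value iteration for r with explorative rules has to miss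
this value. Its action values before layer h are linear, q_k = φ·w_k, but no norm bound on w_k is at
hand. Rescaling w_k into the covered ball keeps greedy rules greedy and multiplies the loss by
max(1, ‖w_k‖/(2H√d)). Excitation controls this factor: q_k lies in [0,1], so (w_k·φ)² ≤ q_k and
λ‖w_k‖² ≤ G, where G bounds the mean of every q_k under every policy. The result is the
self-bounding inequality G ≤ λ/6 + (λ/4) max(1, G/(8λ)), incompatible with G ≥ 2λ/3.

The cover sizes come from volume bounds, applied to the weights and, in Frobenius norm, to the
matrices (I+Σ)⁻¹. -/

open Matrix in
theorem Matrix.IsHermitian.sInf_spectrum_mul_le {n : Type*} [Fintype n] [DecidableEq n]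
    {X : Matrix n n ℝ} (hX : X.IsHermitian) (x : n → ℝ) :
    sInf (spectrum ℝ X) * (x ⬝ᵥ x) ≤ x ⬝ᵥ (X *ᵥ x) := by
  set c := sInf (spectrum ℝ X) with hc
  have hbdd : BddBelow (spectrum ℝ X) := by
    rw [hX.spectrum_real_eq_range_eigenvalues]
    exact (Set.finite_range _).bddBelow
  have hpsd : (X - algebraMap ℝ (Matrix n n ℝ) c).PosSemidef := by
    rw [posSemidef_iff_isHermitian_and_spectrum_nonneg]
    refine ⟨?_, ?_⟩
    · refine hX.sub ?_
      rw [Algebra.algebraMap_eq_smul_one]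
      exact isHermitian_one.smul (by simp [IsSelfAdjoint])
    · intro a ha
      rw [← spectrum.sub_singleton_eq] at ha
      obtain ⟨b, hb, e, he, rfl⟩ := Set.mem_sub.1 ha
      rw [Set.mem_singleton_iff] at he
      subst he
      exact sub_nonneg.2 (csInf_le hbdd hb)
  have := hpsd.dotProduct_mulVec_nonneg x
  simpa [sub_mulVec, Algebra.algebraMap_eq_smul_one, smul_mulVec, dotProduct_sub] using this

open Matrix in
theorem Matrix.IsHermitian.le_sInf_spectrum {n : Type*} [Fintype n] [DecidableEq n] [Nonempty n]
    {X : Matrix n n ℝ} (hX : X.IsHermitian) {c : ℝ}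
    (h : ∀ x : n → ℝ, x ⬝ᵥ x = 1 → c ≤ x ⬝ᵥ (X *ᵥ x)) : c ≤ sInf (spectrum ℝ X) := by
  rw [hX.spectrum_real_eq_range_eigenvalues]
  refine le_csInf (Set.range_nonempty _) ?_
  rintro _ ⟨i, rfl⟩
  have hv := hX.mulVec_eigenvectorBasis i
  have hn : (hX.eigenvectorBasis i).ofLp ⬝ᵥ (hX.eigenvectorBasis i).ofLp = 1 := by
    have h1 := hX.eigenvectorBasis.orthonormal.1 i
    have h2 := EuclideanSpace.real_norm_sq_eq (hX.eigenvectorBasis i)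
    rw [h1] at h2
    simp only [dotProduct, ← sq]
    rw [← h2]; norm_num
  have := h _ hn
  rw [hv, dotProduct_smul, hn] at this
  simpa using this

/-- A weighted Cauchy-Schwarz inequality for the quadratic forms of `M` and `M⁻¹`. -/
theorem Matrix.PosDef.sq_dotProduct_le {n : Type*} [Fintype n] [DecidableEq n]
    {M : Matrix n n ℝ} (hM : M.PosDef) (v y : n → ℝ) :
    (v ⬝ᵥ y) ^ 2 ≤ (v ⬝ᵥ (M *ᵥ v)) * (y ⬝ᵥ (M⁻¹ *ᵥ y)) := by
  have hMy : M *ᵥ (M⁻¹ *ᵥ y) = y := by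
    rw [Matrix.mulVec_mulVec, Matrix.mul_nonsing_inv _ ((Matrix.isUnit_iff_isUnit_det _).1 hM.isUnit),
      Matrix.one_mulVec]
  have hsym : ∀ a b : n → ℝ, a ⬝ᵥ (M *ᵥ b) = b ⬝ᵥ (M *ᵥ a) := fun a b => by
    rw [Matrix.dotProduct_mulVec, ← Matrix.mulVec_transpose, dotProduct_comm]
    congr 2
    simpa using hM.isHermitian.eq
  set z := M⁻¹ *ᵥ y
  -- This polynomial in t is the quadratic form of M at v - t z with z = M⁻¹y; its discriminant
  -- gives the inequality.
  have key : ∀ t : ℝ, 0 ≤ (y ⬝ᵥ z) * (t * t) + (-2 * (v ⬝ᵥ y)) * t + v ⬝ᵥ (M *ᵥ v) := fun t => by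
    have h := hM.posSemidef.dotProduct_mulVec_nonneg (v - t • z)
    have h2 : z ⬝ᵥ (M *ᵥ v) = v ⬝ᵥ y := by rw [hsym, hMy]
    simp only [star_trivial, Matrix.mulVec_sub, Matrix.mulVec_smul, hMy, sub_dotProduct,
      dotProduct_sub, smul_dotProduct, dotProduct_smul, smul_eq_mul, h2, dotProduct_comm z y] at h
    linarith
  have := discrim_le_zero key
  rw [discrim] at this
  nlinarith

/-- If the determinant does not increase from `M` in the direction `D`, the directional
derivative of its logarithm is nonpositive. -/
theorem Matrix.trace_inv_mul_nonpos_of_det_le {n : Type*} [Fintype n] [DecidableEq n]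
    {M D : Matrix n n ℝ} (hM : 0 < M.det)
    (h : ∀ s ∈ Set.Icc (0 : ℝ) 1, (M + s • D).det ≤ M.det) : (M⁻¹ * D).trace ≤ 0 := by
  have hu : IsUnit M.det := hM.ne'.isUnit
  have h1 : ∀ s ∈ Set.Icc (0 : ℝ) 1, (1 + s • (M⁻¹ * D)).det ≤ 1 := fun s hs => by
    have h2 : M + s • D = M * (1 + s • (M⁻¹ * D)) := by
      rw [mul_add, mul_one, mul_smul_comm, ← mul_assoc, Matrix.mul_nonsing_inv _ hu, one_mul]
    have h3 := h s hs
    rw [h2, Matrix.det_mul] at h3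
    nlinarith
  by_contra! hpos
  set τ := (M⁻¹ * D).trace
  -- P is the remainder in det(1 + sN) = 1 + τ s + P(s) s², N = M⁻¹D. If τ > 0, the determinant
  -- exceeds 1 for small s > 0.
  set P := (Matrix.det (1 + (Polynomial.X : Polynomial ℝ) •
    (M⁻¹ * D).map Polynomial.C)).divX.divX with hP
  have hlim : Filter.Tendsto (fun s : ℝ => τ + P.eval s * s) (nhdsWithin 0 (Set.Ioi 0))
      (nhds τ) := by
    have : Filter.Tendsto (fun s : ℝ => τ + P.eval s * s) (nhds 0) (nhds (τ + P.eval 0 * 0)) :=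
      (Continuous.tendsto (by fun_prop) 0)
    simp only [mul_zero, add_zero] at this
    exact this.mono_left nhdsWithin_le_nhds
  have hev := hlim.eventually_const_lt hpos
  have hev2 : ∀ᶠ s : ℝ in nhdsWithin 0 (Set.Ioi 0), s ∈ Set.Ioc (0 : ℝ) 1 :=
    Ioc_mem_nhdsGT one_pos
  obtain ⟨s, hs, hs0, hs1⟩ := (hev.and hev2).exists
  have h4 := h1 s ⟨hs0.le, hs1⟩
  rw [Matrix.det_one_add_smul] at h4
  nlinarith [mul_pos hs hs0]

/-! ### Covers of bounded sets by volume comparison. -/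

/-- The volumetric bound on the size of a separated set in a ball. -/
theorem card_le_of_separated_of_norm_le {E : Type*} [NormedAddCommGroup E] [NormedSpace ℝ E]
    [FiniteDimensional ℝ E] {ρ δ : ℝ} (hρ : 0 ≤ ρ) (hδ : 0 < δ) (s : Finset E)
    (hs : ∀ c ∈ s, ‖c‖ ≤ ρ) (h : ∀ c ∈ s, ∀ e ∈ s, c ≠ e → δ ≤ ‖c - e‖) :
    (s.card : ℝ) ≤ (1 + 2 * ρ / δ) ^ Module.finrank ℝ E := by
  borelize E
  let μ : Measure E := Measure.addHaar
  have δpos : 0 < δ / 2 := by positivity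
  have ρpos : 0 < ρ + δ / 2 := by positivity
  have D : Set.Pairwise (s : Set E) (Function.onFun Disjoint fun c => Metric.ball c (δ / 2)) := by
    rintro c hc e he hce
    apply Metric.ball_disjoint_ball
    rw [dist_eq_norm, add_halves]
    exact h c hc e he hce
  have A_subset : (⋃ c ∈ s, Metric.ball (c : E) (δ / 2)) ⊆ Metric.ball (0 : E) (ρ + δ / 2) := by
    refine Set.iUnion₂_subset fun x hx => Metric.ball_subset_ball' ?_
    rw [dist_zero_right]
    linarith [hs x hx]
  have I : (s.card : ENNReal) * ENNReal.ofReal ((δ / 2) ^ Module.finrank ℝ E) *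
      μ (Metric.ball 0 1) ≤
      ENNReal.ofReal ((ρ + δ / 2) ^ Module.finrank ℝ E) * μ (Metric.ball 0 1) := by
    have h1 := measure_mono (μ := μ) A_subset
    rw [measure_biUnion_finset D fun c _ => measurableSet_ball] at h1
    simp only [μ.addHaar_ball_of_pos _ δpos, μ.addHaar_ball_of_pos _ ρpos] at h1
    simpa only [Finset.sum_const, nsmul_eq_mul, mul_assoc] using h1
  have J := (ENNReal.mul_le_mul_iff_left (Metric.measure_ball_pos _ _ zero_lt_one).ne'
    measure_ball_lt_top.ne).1 I
  have K := ENNReal.toReal_le_of_le_ofReal (pow_nonneg ρpos.le _) J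
  rw [ENNReal.toReal_mul, ENNReal.toReal_natCast, ENNReal.toReal_ofReal (by positivity),
    ← le_div_iff₀ (by positivity), ← div_pow] at K
  have e : (ρ + δ / 2) / (δ / 2) = 1 + 2 * ρ / δ := by
    field_simp
    ring
  rwa [e] at K

/-- A bounded set has a finite internal cover of the size given by the volumetric bound. -/
theorem exists_finset_cover_card_le {E : Type*} [NormedAddCommGroup E] [NormedSpace ℝ E]
    [FiniteDimensional ℝ E] {ρ δ : ℝ} (hρ : 0 ≤ ρ) (hδ : 0 < δ) (K : Set E)
    (hK : ∀ c ∈ K, ‖c‖ ≤ ρ) :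
    ∃ t : Finset E, (∀ c ∈ t, c ∈ K) ∧ (∀ x ∈ K, ∃ c ∈ t, ‖x - c‖ ≤ δ) ∧
      (t.card : ℝ) ≤ (1 + 2 * ρ / δ) ^ Module.finrank ℝ E := by
  classical
  let good : Finset E → Prop := fun s =>
    (∀ c ∈ s, c ∈ K) ∧ ∀ c ∈ s, ∀ e ∈ s, c ≠ e → δ ≤ ‖c - e‖
  have hcard : ∀ s, good s → (s.card : ℝ) ≤ (1 + 2 * ρ / δ) ^ Module.finrank ℝ E := fun s hs =>
    card_le_of_separated_of_norm_le hρ hδ s (fun c hc => hK c (hs.1 c hc)) hs.2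
  have hfin : (Finset.card '' {s | good s}).Finite := by
    refine (Set.finite_Iic ⌊(1 + 2 * ρ / δ) ^ Module.finrank ℝ E⌋₊).subset ?_
    rintro _ ⟨s, hs, rfl⟩
    exact Nat.le_floor (hcard s hs)
  -- The volume bound leaves finitely many cardinalities, so a largest separated set exists. A point
  -- of K farther than δ from all of it could be added.
  obtain ⟨_, ⟨t, ht, rfl⟩, hmax⟩ := hfin.exists_maximal
    ⟨0, ∅, ⟨by simp, by simp⟩, rfl⟩
  refine ⟨t, ht.1, fun x hx => ?_, hcard t ht⟩
  by_contra! hcon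
  have hxt : x ∉ t := fun hx' => by
    have := hcon x hx'
    simp at this; linarith
  have hgood : good (insert x t) := by
    refine ⟨?_, ?_⟩
    · intro c hc
      rcases Finset.mem_insert.1 hc with rfl | hc
      exacts [hx, ht.1 c hc]
    · intro c hc e he hce
      rcases Finset.mem_insert.1 hc with hc' | hc' <;>
        rcases Finset.mem_insert.1 he with he' | he'
      · exact absurd (hc'.trans he'.symm) hce
      · rw [hc']; exact (hcon e he').le
      · rw [he', norm_sub_rev]; exact (hcon c hc').le
      · exact ht.2 c hc' e he' hce
  have := hmax ⟨_, hgood, rfl⟩ (Finset.card_le_card (Finset.subset_insert x t))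
  simp only [Finset.card_insert_of_notMem hxt] at this
  omega

theorem Real.abs_sqrt_sub_sqrt_le_sqrt_abs_sub {a b : ℝ} (ha : 0 ≤ a) (hb : 0 ≤ b) :
    |√a - √b| ≤ √|a - b| := by
  refine Real.le_sqrt_of_sq_le ?_
  have h1 := Real.sq_sqrt ha
  have h2 := Real.sq_sqrt hb
  have h3 := Real.sqrt_nonneg a
  have h4 := Real.sqrt_nonneg b
  have h5 : a - b = (√a - √b) * (√a + √b) := by ring_nf; linarith
  rw [h5, abs_mul, sq]
  refine mul_le_mul_of_nonneg_left ?_ (abs_nonneg _)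
  rw [abs_of_nonneg (add_nonneg h3 h4), abs_le]
  constructor <;> linarith

theorem Real.log_natCast_le_mul_log_of_le_pow {n k : ℕ} {b : ℝ} (hb : 1 ≤ b)
    (h : (n : ℝ) ≤ b ^ k) : Real.log n ≤ k * Real.log b := by
  rcases n.eq_zero_or_pos with rfl | hn
  · simpa using mul_nonneg k.cast_nonneg (Real.log_nonneg hb)
  · rw [← Real.log_pow]
    exact Real.log_le_log (by exact_mod_cast hn) h

/-! ### The matrices (I+X)⁻¹ and the exploration rewards. -/

namespace LinMDP

section LinearAlgebra

variable {n : Type*} [Fintype n] [DecidableEq n]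

theorem posDef_one_add {m : Type*} [DecidableEq m] {X : Matrix m m ℝ} (hX : X.PosSemidef) : (1 + X).PosDef :=
  Matrix.PosDef.one.add_posSemidef hX

theorem one_add_mulVec_inv {X : Matrix n n ℝ} (hX : X.PosSemidef) (x : n → ℝ) :
    (1 + X) *ᵥ ((1 + X)⁻¹ *ᵥ x) = x := by
  rw [Matrix.mulVec_mulVec, Matrix.mul_nonsing_inv _
    ((Matrix.isUnit_iff_isUnit_det _).1 (posDef_one_add hX).isUnit), Matrix.one_mulVec]

/-- With y = (1+X)⁻¹x one has x·y = y·y + y·Xy, and the last term is nonnegative. -/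
theorem inv_mulVec_dotProduct_self_le {X : Matrix n n ℝ} (hX : X.PosSemidef) (x : n → ℝ) :
    ((1 + X)⁻¹ *ᵥ x) ⬝ᵥ ((1 + X)⁻¹ *ᵥ x) ≤ x ⬝ᵥ ((1 + X)⁻¹ *ᵥ x) := by
  have h1 := one_add_mulVec_inv hX x
  set y := (1 + X)⁻¹ *ᵥ x
  have h2 := hX.dotProduct_mulVec_nonneg y
  simp only [star_trivial] at h2
  rw [Matrix.add_mulVec, Matrix.one_mulVec] at h1
  rw [← h1, add_dotProduct, dotProduct_comm (X *ᵥ y)]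
  linarith

theorem dotProduct_inv_mulVec_nonneg {X : Matrix n n ℝ} (hX : X.PosSemidef) (x : n → ℝ) :
    0 ≤ x ⬝ᵥ ((1 + X)⁻¹ *ᵥ x) :=
  le_trans (by simpa using dotProduct_star_self_nonneg ((1 + X)⁻¹ *ᵥ x))
    (inv_mulVec_dotProduct_self_le hX x)

theorem dotProduct_inv_mulVec_le {X : Matrix n n ℝ} (hX : X.PosSemidef) (x : n → ℝ) :
    x ⬝ᵥ ((1 + X)⁻¹ *ᵥ x) ≤ x ⬝ᵥ x := by
  have h1 := inv_mulVec_dotProduct_self_le hX x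
  set y := (1 + X)⁻¹ *ᵥ x
  have h2 : 0 ≤ (x - y) ⬝ᵥ (x - y) := by simpa using dotProduct_star_self_nonneg (x - y)
  simp only [sub_dotProduct, dotProduct_sub, dotProduct_comm y x] at h2
  linarith

theorem dotProduct_self_eq_norm_sq {d : ℕ} (v : EuclideanSpace ℝ (Fin d)) :
    v.ofLp ⬝ᵥ v.ofLp = ‖v‖ ^ 2 := by
  rw [EuclideanSpace.real_norm_sq_eq]
  simp [dotProduct, sq]

/-- Cauchy-Schwarz over pairs of indices: the form is the Frobenius pairing of D with xxᵀ, whose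
norm is x·x. -/
theorem abs_dotProduct_mulVec_le {m : Type*} [Fintype m] (D : Matrix m m ℝ) (x : m → ℝ) :
    |x ⬝ᵥ (D *ᵥ x)| ≤ ‖WithLp.toLp 2 (fun p : m × m => D p.1 p.2)‖ * (x ⬝ᵥ x) := by
  refine abs_le_of_sq_le_sq ?_ (mul_nonneg (norm_nonneg _)
    (by simpa using dotProduct_star_self_nonneg x))
  rw [mul_pow, EuclideanSpace.real_norm_sq_eq]
  have h1 : x ⬝ᵥ (D *ᵥ x) = ∑ p : m × m, D p.1 p.2 * (x p.1 * x p.2) := by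
    rw [Fintype.sum_prod_type]
    simp only [dotProduct, Matrix.mulVec, Finset.mul_sum]
    exact Finset.sum_congr rfl fun i _ => Finset.sum_congr rfl fun j _ => by ring
  have h2 : (x ⬝ᵥ x) ^ 2 = ∑ p : m × m, (x p.1 * x p.2) ^ 2 := by
    rw [Fintype.sum_prod_type, sq]
    simp only [dotProduct, Finset.sum_mul_sum]
    exact Finset.sum_congr rfl fun i _ => Finset.sum_congr rfl fun j _ => by ring
  rw [h1, h2]
  exact Finset.sum_mul_sq_le_sq_mul_sq _ _ _

/-- Each column (1+X)⁻¹eⱼ has length at most 1, and the squared Frobenius norm sums over the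
columns. -/
theorem norm_inv_one_add_le {X : Matrix n n ℝ} (hX : X.PosSemidef) :
    ‖WithLp.toLp 2 (fun p : n × n => (1 + X)⁻¹ p.1 p.2)‖ ≤ √(Fintype.card n : ℝ) := by
  refine Real.le_sqrt_of_sq_le ?_
  rw [EuclideanSpace.real_norm_sq_eq, Fintype.sum_prod_type, Finset.sum_comm]
  refine (Finset.sum_le_card_nsmul _ _ 1 fun j _ => ?_).trans (by simp)
  have h := (inv_mulVec_dotProduct_self_le hX (Pi.single j 1)).trans
    ((dotProduct_inv_mulVec_le hX (Pi.single j 1)).trans_eq (by simp : _ = (1 : ℝ)))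
  simpa [dotProduct, sq, Matrix.mulVec_single] using h

end LinearAlgebra

section Reward

variable {S A : Type*} {d : ℕ} {φ : S × A → EuclideanSpace ℝ (Fin d)}

theorem explReward_nonneg (X : Matrix (Fin d) (Fin d) ℝ) (x : S × A) : 0 ≤ explReward φ X x :=
  Real.sqrt_nonneg _

theorem sq_explReward {X : Matrix (Fin d) (Fin d) ℝ} (hX : X.PosSemidef) (x : S × A) :
    explReward φ X x ^ 2 = (φ x).ofLp ⬝ᵥ ((1 + X)⁻¹ *ᵥ (φ x).ofLp) :=
  Real.sq_sqrt (dotProduct_inv_mulVec_nonneg hX _)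

theorem explReward_le_one (hφ1 : ∀ x, ‖φ x‖ ≤ 1) {X : Matrix (Fin d) (Fin d) ℝ}
    (hX : X.PosSemidef) (x : S × A) : explReward φ X x ≤ 1 := by
  refine Real.sqrt_le_one.2 ((dotProduct_inv_mulVec_le hX _).trans ?_)
  rw [dotProduct_self_eq_norm_sq]
  exact pow_le_one₀ (norm_nonneg _) (hφ1 x)

theorem measurable_explReward [MeasurableSpace S] [MeasurableSpace A] (hφ : Measurable φ)
    (X : Matrix (Fin d) (Fin d) ℝ) : Measurable (explReward φ X) := by
  have h : Continuous fun v : EuclideanSpace ℝ (Fin d) =>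
      √(v.ofLp ⬝ᵥ ((1 + X)⁻¹ *ᵥ v.ofLp)) := by fun_prop
  exact h.measurable.comp hφ

theorem abs_explReward_sub_le (hφ1 : ∀ x, ‖φ x‖ ≤ 1) {X Y : Matrix (Fin d) (Fin d) ℝ}
    (hX : X.PosSemidef) (hY : Y.PosSemidef) (x : S × A) :
    |explReward φ X x - explReward φ Y x| ≤
      √‖WithLp.toLp 2 (fun p : Fin d × Fin d => (1 + X)⁻¹ p.1 p.2) -
        WithLp.toLp 2 (fun p : Fin d × Fin d => (1 + Y)⁻¹ p.1 p.2)‖ := by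
  refine (Real.abs_sqrt_sub_sqrt_le_sqrt_abs_sub (dotProduct_inv_mulVec_nonneg hX _)
    (dotProduct_inv_mulVec_nonneg hY _)).trans (Real.sqrt_le_sqrt ?_)
  rw [← dotProduct_sub, ← Matrix.sub_mulVec]
  refine (abs_dotProduct_mulVec_le _ _).trans ?_
  rw [dotProduct_self_eq_norm_sq]
  refine (mul_le_of_le_one_right (norm_nonneg _)
    (pow_le_one₀ (norm_nonneg _) (hφ1 x))).trans (le_of_eq ?_)
  rfl

/-- Weighted Cauchy-Schwarz bounds (v·φ)² by 2r², and plain Cauchy-Schwarz by 1. The geometric mean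
of the two is √2 r ≤ (3/2) r, linear in the reward as value iteration needs. -/
theorem sq_dotProduct_le_explReward (hφ1 : ∀ x, ‖φ x‖ ≤ 1) {X : Matrix (Fin d) (Fin d) ℝ}
    (hX : X.PosSemidef) {v : Fin d → ℝ} (hv : v ⬝ᵥ v = 1) (hvX : v ⬝ᵥ (X *ᵥ v) ≤ 1)
    (x : S × A) : (v ⬝ᵥ (φ x).ofLp) ^ 2 ≤ 3 / 2 * explReward φ X x := by
  have h1 := (posDef_one_add hX).sq_dotProduct_le v (φ x).ofLp
  rw [← sq_explReward hX, Matrix.add_mulVec, Matrix.one_mulVec, dotProduct_add, hv] at h1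
  have hr := explReward_nonneg (φ := φ) X x
  set r := explReward φ X x
  set b := v ⬝ᵥ (φ x).ofLp with hb
  have h2 : b ^ 2 ≤ 2 * r ^ 2 := by nlinarith [sq_nonneg r]
  have h3 : b ^ 2 ≤ 1 := by
    have h4 : b ^ 2 ≤ (v ⬝ᵥ v) * ((φ x).ofLp ⬝ᵥ (φ x).ofLp) := by
      have := Finset.sum_mul_sq_le_sq_mul_sq Finset.univ v (φ x).ofLp
      simpa [hb, dotProduct, sq] using this
    rw [hv, one_mul, dotProduct_self_eq_norm_sq] at h4
    exact h4.trans (pow_le_one₀ (norm_nonneg _) (hφ1 x))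
  refine le_of_sq_le_sq ?_ (by positivity)
  nlinarith [sq_nonneg b]

end Reward

/-! ### Existence and cardinality of the explorative sets. -/

variable {S A : Type*} [MeasurableSpace S] [MeasurableSpace A] {d H : ℕ}
  {φ : S × A → EuclideanSpace ℝ (Fin d)} {ε : ℝ}

/-- The covers of the construction exist in the prescribed sizes. -/
theorem exists_isSmall (hH : 1 ≤ H) (hφ1 : ∀ x, ‖φ x‖ ≤ 1) (hε : 0 < ε)
    (hw : ∀ w, ∃ f : DetRule S A, IsGreedy (linFun φ w) f)
    (hr : ∀ X : Matrix (Fin d) (Fin d) ℝ, X.PosSemidef →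
      ∃ f : DetRule S A, IsGreedy (explReward φ X) f) :
    ∃ C : ExpConstruction φ H ε, C.IsSmall := by
  classical
  have hH0 : (0 : ℝ) < H := by exact_mod_cast hH
  obtain ⟨W, -, hWc, hWn⟩ := exists_finset_cover_card_le (E := EuclideanSpace ℝ (Fin d))
    (ρ := 2 * H * √(d : ℝ)) (δ := ε / (2 * H)) (by positivity) (by positivity)
    {v | ‖v‖ ≤ 2 * H * √(d : ℝ)} (fun _ h => h)
  -- The radius is squared because the reward is only 1/2-Hölder in (1+X)⁻¹. The cover is internal,
  -- so its elements are true rewards and have greedy rules by hypothesis.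
  obtain ⟨t, htK, htc, htn⟩ := exists_finset_cover_card_le
    (E := EuclideanSpace ℝ (Fin d × Fin d))
    (ρ := √(d : ℝ)) (δ := (ε / (2 * H)) ^ 2) (by positivity) (by positivity)
    {v | ∃ X : Matrix (Fin d) (Fin d) ℝ, X.PosSemidef ∧
      WithLp.toLp 2 (fun p : Fin d × Fin d => (1 + X)⁻¹ p.1 p.2) = v}
    (by rintro _ ⟨X, hX, rfl⟩; simpa using norm_inv_one_add_le hX)
  choose! Z hZ hZe using htK
  choose fw hfw using hw
  have hdef : ∀ r : S × A → ℝ, ∃ f : DetRule S A,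
      (∃ X : Matrix (Fin d) (Fin d) ℝ, X.PosSemidef ∧ r = explReward φ X) → IsGreedy r f := by
    intro r
    by_cases h : ∃ X : Matrix (Fin d) (Fin d) ℝ, X.PosSemidef ∧ r = explReward φ X
    · obtain ⟨X, hX, rfl⟩ := h
      obtain ⟨f, hf⟩ := hr X hX
      exact ⟨f, fun _ => hf⟩
    · exact ⟨fw 0, fun h' => absurd h' h⟩
  choose fr hfr using hdef
  refine ⟨{
    W := W
    R := t.image fun c => explReward φ (Z c)
    W_cover := hWc
    R_cover := fun X hX => ?_
    ruleW := fun _ => fw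
    ruleR := fun _ => fr
    ruleW_greedy := fun _ w _ => hfw w
    ruleR_greedy := fun _ r hr => ?_ }, ?_, ?_⟩
  · obtain ⟨c, hc, hXc⟩ := htc _ ⟨X, hX, rfl⟩
    refine ⟨_, Finset.mem_image_of_mem _ hc, fun x => ?_⟩
    refine (abs_explReward_sub_le hφ1 hX (hZ c hc) x).trans ?_
    rw [hZe c hc]
    exact Real.sqrt_le_iff.2 ⟨by positivity, hXc⟩
  · obtain ⟨c, hc, rfl⟩ := Finset.mem_image.1 hr
    exact hfr _ ⟨_, hZ c hc, rfl⟩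
  · have e : 1 + 2 * (2 * H * √(d : ℝ)) / (ε / (2 * H)) = 1 + 8 * H ^ 2 * √(d : ℝ) / ε := by
      field_simp
      ring
    rw [finrank_euclideanSpace_fin, e] at hWn
    refine Real.log_natCast_le_mul_log_of_le_pow ?_ hWn
    have : 0 ≤ 8 * H ^ 2 * √(d : ℝ) / ε := by positivity
    linarith
  · have e : 1 + 2 * √(d : ℝ) / (ε / (2 * H)) ^ 2 ≤ 1 + 32 * H ^ 2 * √(d : ℝ) / ε ^ 2 := by
      have : 2 * √(d : ℝ) / (ε / (2 * H)) ^ 2 = 8 * H ^ 2 * √(d : ℝ) / ε ^ 2 := by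
        field_simp
        ring
      rw [this]
      gcongr
      norm_num
    have hn : (((t.image fun c => explReward φ (Z c)).card : ℕ) : ℝ) ≤
        (1 + 32 * H ^ 2 * √(d : ℝ) / ε ^ 2) ^ (d ^ 2) := by
      refine le_trans (by exact_mod_cast Finset.card_image_le) (htn.trans ?_)
      rw [finrank_euclideanSpace, Fintype.card_prod, Fintype.card_fin, ← sq]
      gcongr
    have := Real.log_natCast_le_mul_log_of_le_pow (by
      have : 0 ≤ 32 * H ^ 2 * √(d : ℝ) / ε ^ 2 := by positivity
      linarith) hn
    simpa using this

/-- Each cover has at most exp(d²L) elements, so their union costs an extra log 2, absorbed by log 2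
≤ L ≤ d²L. -/
theorem ExpConstruction.IsSmall.log_card_layer_le (hd : 2 ≤ d) (hH : 1 ≤ H) (hε : 0 < ε)
    (hε1 : ε ≤ 1) {C : ExpConstruction φ H ε} (hC : C.IsSmall) (h : Fin H) :
    Real.log (C.layer h).card ≤
      2 * d ^ 2 * Real.log (1 + 32 * H ^ 2 * √(d : ℝ) / ε ^ 2) := by
  classical
  have hH1 : (1 : ℝ) ≤ H := by exact_mod_cast hH
  have hd2 : (2 : ℝ) ≤ d := by exact_mod_cast hd
  set L := Real.log (1 + 32 * H ^ 2 * √(d : ℝ) / ε ^ 2) with hL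
  have hbase : 8 * H ^ 2 * √(d : ℝ) / ε ≤ 32 * H ^ 2 * √(d : ℝ) / ε ^ 2 := by
    have : ε ^ 2 ≤ ε := by nlinarith
    gcongr
    norm_num
  have hbase1 : 1 ≤ 32 * H ^ 2 * √(d : ℝ) / ε ^ 2 := by
    rw [one_le_div (by positivity)]
    have h1 : 1 ≤ √(d : ℝ) := Real.one_le_sqrt.2 (by linarith)
    have h2 : ε ^ 2 ≤ 1 := by nlinarith
    nlinarith [mul_le_mul (one_le_pow₀ hH1 : 1 ≤ (H : ℝ) ^ 2) h1 zero_le_one (by positivity)]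
  have hlog2 : Real.log 2 ≤ L := Real.log_le_log two_pos (by linarith)
  have hL0 : 0 < L := lt_of_lt_of_le (Real.log_pos one_lt_two) hlog2
  have hlogW : Real.log (1 + 8 * H ^ 2 * √(d : ℝ) / ε) ≤ L :=
    Real.log_le_log (by positivity) (by linarith)
  have hWR : (d : ℝ) * Real.log (1 + 8 * H ^ 2 * √(d : ℝ) / ε) ≤ d ^ 2 * L := by
    calc _ ≤ (d : ℝ) * L := by gcongr
      _ ≤ d ^ 2 * L := by gcongr; nlinarith
  have hexp : ∀ n : ℕ, Real.log n ≤ d ^ 2 * L → (n : ℝ) ≤ Real.exp (d ^ 2 * L) := by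
    intro n hn
    rcases n.eq_zero_or_pos with rfl | hn0
    · simpa using (Real.exp_pos _).le
    · exact (Real.log_le_iff_le_exp (by exact_mod_cast hn0)).1 hn
  have hcard : ((C.layer h).card : ℝ) ≤ 2 * Real.exp (d ^ 2 * L) := by
    have h1 : (C.layer h).card ≤ C.R.card + C.W.card :=
      (Finset.card_union_le _ _).trans (add_le_add Finset.card_image_le Finset.card_image_le)
    have h2 : ((C.layer h).card : ℝ) ≤ C.R.card + C.W.card := by exact_mod_cast h1
    linarith [hexp _ hC.2, hexp _ (hC.1.trans hWR)]
  rcases (C.layer h).card.eq_zero_or_pos with h0 | h0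
  · rw [h0]; simp; positivity
  · have h1 : Real.log (C.layer h).card ≤ Real.log 2 + d ^ 2 * L := by
      have := Real.log_le_log (by exact_mod_cast h0) hcard
      rwa [Real.log_mul two_ne_zero (Real.exp_ne_zero _), Real.log_exp] at this
    have h2 : L ≤ d ^ 2 * L := le_mul_of_one_le_left hL0.le (by nlinarith)
    linarith

end LinMDP

/-! ### Trajectory laws, performance difference and linearity of the transitions. -/

theorem MeasureTheory.integrable_of_measurable_of_mem_Icc {α : Type*} [MeasurableSpace α]
    {μ : Measure α} [IsFiniteMeasure μ] {f : α → ℝ} (hf : Measurable f) {a b : ℝ}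
    (h : ∀ x, f x ∈ Set.Icc a b) : Integrable f μ :=
  Integrable.of_mem_Icc a b hf.aemeasurable (Filter.Eventually.of_forall h)

namespace LinMDP

variable {S A : Type*} [MeasurableSpace S] [MeasurableSpace A] {d H : ℕ}
  {φ : S × A → EuclideanSpace ℝ (Fin d)}

instance (M : LinearMDP φ H) (h : Fin H) : IsMarkovKernel (M.P h) := M.markov h

instance (π : Policy S A H) (h : Fin H) : IsMarkovKernel (π.act h) := π.markov h

instance (π : Policy S A H) (n : ℕ) (hn : n < H) :
    @IsMarkovKernel ((Fin n → S × A) × S) A _ _ (π.act ⟨n, hn⟩) := π.markov _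

theorem measurable_snoc_step (n : ℕ) :
    Measurable (fun z : (((Fin n → S × A) × S) × A) × S =>
      ((Fin.snoc (α := fun _ => S × A) z.1.1.1 (z.1.1.2, z.1.2) : Fin (n + 1) → S × A), z.2)) := by
  refine Measurable.prodMk ?_ measurable_snd
  refine measurable_pi_lambda _ fun i => ?_
  refine Fin.lastCases ?_ (fun j => ?_) i
  · simp only [Fin.snoc_last]
    fun_prop
  · simp only [Fin.snoc_castSucc]
    fun_prop

instance isProbabilityMeasure_histLaw (M : LinearMDP φ H) (π : Policy S A H) :
    ∀ (n : ℕ) (hn : n < H), IsProbabilityMeasure (histLaw M π n hn)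
  | 0, _ => by rw [histLaw]; infer_instance
  | n + 1, hn => by
    have := isProbabilityMeasure_histLaw M π n (Nat.lt_of_succ_lt hn)
    rw [histLaw]
    exact Measure.isProbabilityMeasure_map (measurable_snoc_step n).aemeasurable

instance isProbabilityMeasure_occ (M : LinearMDP φ H) (π : Policy S A H) (h : Fin H) :
    IsProbabilityMeasure (occ M π h) :=
  Measure.isProbabilityMeasure_map (by fun_prop)

theorem integral_histLaw_zero (M : LinearMDP φ H) (π : Policy S A H) (hH : 0 < H) {V : S → ℝ}
    (hV : Measurable V) : ∫ z, V z.2 ∂histLaw M π 0 hH = V M.init := by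
  rw [histLaw]
  exact integral_dirac' (fun z : (Fin 0 → S × A) × S => V z.2) _
    (hV.comp measurable_snd).stronglyMeasurable

theorem integral_histLaw_succ (M : LinearMDP φ H) (π : Policy S A H) {n : ℕ} (hn : n + 1 < H)
    {V : S → ℝ} (hV : Measurable V) (hV1 : ∀ s, V s ∈ Set.Icc (0 : ℝ) 1) :
    ∫ z, V z.2 ∂histLaw M π (n + 1) hn =
      ∫ x, (∫ s, V s ∂M.P ⟨n, Nat.lt_of_succ_lt hn⟩ x) ∂occ M π ⟨n, Nat.lt_of_succ_lt hn⟩ := by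
  have hm : Measurable fun z : (Fin (n + 1) → S × A) × S => V z.2 := hV.comp measurable_snd
  have hm' : Measurable fun z : (((Fin n → S × A) × S) × A) × S => V z.2 := hV.comp measurable_snd
  rw [histLaw, integral_map (measurable_snoc_step n).aemeasurable hm.aestronglyMeasurable, occ, integral_map (by fun_prop)
    (hV.stronglyMeasurable.integral_kernel).aestronglyMeasurable]
  rw [Measure.integral_compProd (integrable_of_measurable_of_mem_Icc hm' fun z => hV1 z.2)]
  simp only [Kernel.comap_apply]

/-- The greedy loss is bounded pointwise in the action, so the bound survives any history-dependent
randomization. -/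
theorem integral_occ_le (M : LinearMDP φ H) (π : Policy S A H) {n : ℕ} (hn : n < H)
    {q : S × A → ℝ} (hq : Measurable q) (hq1 : ∀ x, q x ∈ Set.Icc (0 : ℝ) 1)
    {V : S → ℝ} (hV : Measurable V) (hV1 : ∀ s, V s ∈ Set.Icc (0 : ℝ) 1) {l : ℝ}
    (h : ∀ s a, q (s, a) ≤ V s + l) :
    ∫ x, q x ∂occ M π ⟨n, hn⟩ ≤ ∫ z, V z.2 ∂histLaw M π n hn + l := by
  rw [occ, integral_map (by fun_prop) hq.aestronglyMeasurable]
  have hm : Measurable fun z : ((Fin n → S × A) × S) × A => V z.1.2 :=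
    hV.comp (measurable_snd.comp measurable_fst)
  have hVi : Integrable (fun z : ((Fin n → S × A) × S) × A => V z.1.2)
      (histLaw M π n hn ⊗ₘ π.act ⟨n, hn⟩) :=
    integrable_of_measurable_of_mem_Icc hm fun z => hV1 z.1.2
  calc _ ≤ ∫ z, (V z.1.2 + l) ∂(histLaw M π n hn ⊗ₘ π.act ⟨n, hn⟩) := by
        refine integral_mono ?_ (hVi.add (integrable_const _)) fun z => h _ _
        exact integrable_of_measurable_of_mem_Icc (hq.comp (by fun_prop)) fun z => hq1 _
    _ = ∫ z, V z.1.2 ∂(histLaw M π n hn ⊗ₘ π.act ⟨n, hn⟩) + l := by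
        rw [integral_add hVi (integrable_const _)]
        simp
    _ = _ := by
        rw [Measure.integral_compProd hVi]
        simp

theorem integral_occ_ofRules (M : LinearMDP φ H) (f : Fin H → DetRule S A) {n : ℕ} (hn : n < H)
    {q : S × A → ℝ} (hq : Measurable q) (hq1 : ∀ x, q x ∈ Set.Icc (0 : ℝ) 1) :
    ∫ x, q x ∂occ M (Policy.ofRules f) ⟨n, hn⟩ =
      ∫ z, q (z.2, (f ⟨n, hn⟩).1 z.2) ∂histLaw M (Policy.ofRules f) n hn := by
  rw [occ, integral_map (by fun_prop) hq.aestronglyMeasurable]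
  have hm : Measurable fun z : ((Fin n → S × A) × S) × A => q (z.1.2, z.2) :=
    hq.comp (by fun_prop)
  rw [Measure.integral_compProd (integrable_of_measurable_of_mem_Icc hm fun z => hq1 _)]
  refine integral_congr_ae (Filter.Eventually.of_forall fun z => ?_)
  simp only [Policy.ofRules]
  have hz : Measurable fun b => q (z.2, b) := hq.comp (by fun_prop)
  rw [Kernel.integral_deterministic' _ hz.stronglyMeasurable]

/-- One layer of a value iteration: an action value together with a decision rule. -/
structure LayerValue (S A : Type*) [MeasurableSpace S] [MeasurableSpace A] where
  q : S × A → ℝ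
  rule : DetRule S A
  measurable_q : Measurable q
  q_mem : ∀ x, q x ∈ Set.Icc (0 : ℝ) 1

namespace LayerValue

/-- The state value obtained by following the decision rule. -/
def V (g : LayerValue S A) (s : S) : ℝ := g.q (s, g.rule.1 s)

theorem measurable_V (g : LayerValue S A) : Measurable g.V :=
  g.measurable_q.comp (measurable_id.prodMk g.rule.2)

theorem V_mem (g : LayerValue S A) (s : S) : g.V s ∈ Set.Icc (0 : ℝ) 1 := g.q_mem _

end LayerValue

variable {M : LinearMDP φ H} {h : Fin H} {D : ℕ → LayerValue S A}

/-- Performance difference: an approximately greedy chain of action values bounds the value of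
every policy. -/
theorem integral_occ_le_of_chain
    (hD : ∀ k (hk : k < h.1), ∀ x, (D k).q x = ∫ s, (D (k + 1)).V s ∂M.P ⟨k, hk.trans h.2⟩ x)
    {l : ℕ → ℝ} (hl : ∀ k ≤ h.1, ∀ s a, (D k).q (s, a) ≤ (D k).V s + l k)
    (π : Policy S A H) {k : ℕ} (hk : k ≤ h.1) :
    ∫ x, (D k).q x ∂occ M π ⟨k, hk.trans_lt h.2⟩ ≤
      (D 0).V M.init + ∑ j ∈ Finset.range (k + 1), l j := by
  -- The mean of q at layer k exceeds that of V by at most l k, and the mean of V at layer k+1 is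
  -- that of q at layer k; the losses add up forward in time.
  induction k with
  | zero =>
    refine (integral_occ_le M π _ (D 0).measurable_q (D 0).q_mem (D 0).measurable_V
      (D 0).V_mem (hl 0 hk)).trans_eq ?_
    rw [integral_histLaw_zero M π _ (D 0).measurable_V]
    simp
  | succ k ih =>
    refine (integral_occ_le M π _ (D (k + 1)).measurable_q (D (k + 1)).q_mem
      (D (k + 1)).measurable_V (D (k + 1)).V_mem (hl _ hk)).trans ?_
    rw [integral_histLaw_succ M π _ (D (k + 1)).measurable_V (D (k + 1)).V_mem]
    simp only [← hD k hk]
    rw [Finset.sum_range_succ]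
    linarith [ih (by omega)]

/-- Along its own rules the chain loses nothing: q equals V at the chosen action, so its mean is the
same at all layers up to h. -/
theorem integral_occ_ofRules_of_chain
    (hD : ∀ k (hk : k < h.1), ∀ x, (D k).q x = ∫ s, (D (k + 1)).V s ∂M.P ⟨k, hk.trans h.2⟩ x)
    {f : Fin H → DetRule S A} (hf : ∀ k : Fin H, k ≤ h → f k = (D k).rule)
    {k : ℕ} (hk : k ≤ h.1) :
    ∫ x, (D k).q x ∂occ M (Policy.ofRules f) ⟨k, hk.trans_lt h.2⟩ = (D 0).V M.init := by
  induction k with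
  | zero =>
    rw [integral_occ_ofRules M f _ (D 0).measurable_q (D 0).q_mem, hf _ hk]
    exact integral_histLaw_zero M _ _ (D 0).measurable_V
  | succ k ih =>
    rw [integral_occ_ofRules M f _ (D (k + 1)).measurable_q (D (k + 1)).q_mem, hf _ hk,
      ← ih (by omega)]
    refine (integral_histLaw_succ M _ _ (D (k + 1)).measurable_V (D (k + 1)).V_mem).trans ?_
    simp only [← hD k hk]

/-- Expected values of the next state are linear in the features. -/
theorem exists_integral_eq_inner (M : LinearMDP φ H) (k : Fin H) {V : S → ℝ} (hV : Measurable V)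
    (hV1 : ∀ s, V s ∈ Set.Icc (0 : ℝ) 1) :
    ∃ w : EuclideanSpace ℝ (Fin d), ∀ x, ∫ s, V s ∂M.P k x = inner ℝ (φ x) w := by
  -- The functions φ·w form a finite-dimensional space, hence closed under pointwise limits. Simple
  -- functions therefore suffice, and their weights need not converge.
  let T : EuclideanSpace ℝ (Fin d) →ₗ[ℝ] (S × A → ℝ) :=
    LinearMap.pi fun x => (innerSL ℝ (φ x)).toLinearMap
  have hclosed : IsClosed (LinearMap.range T : Set (S × A → ℝ)) :=
    Submodule.closed_of_finiteDimensional _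
  have hsm := hV.stronglyMeasurable
  have hb : ∀ s, ‖V s‖ ≤ 1 := fun s => by
    rw [Real.norm_eq_abs, abs_le]; exact ⟨by linarith [(hV1 s).1], (hV1 s).2⟩
  have hmem : ∀ g : SimpleFunc S ℝ, (fun x => ∫ s, g s ∂M.P k x) ∈ LinearMap.range T := by
    intro g
    refine ⟨WithLp.toLp 2 fun i => ∑ y ∈ g.range, y * M.μ k i (g ⁻¹' {y}), ?_⟩
    funext x
    rw [← SimpleFunc.integral_eq_integral g (SimpleFunc.integrable_of_isFiniteMeasure g),
      SimpleFunc.integral_eq]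
    simp only [T, LinearMap.pi_apply, ContinuousLinearMap.coe_coe, innerSL_apply_apply,
      PiLp.inner_apply, RCLike.inner_apply, conj_trivial, smul_eq_mul]
    simp only [M.linear k x _ (g.measurableSet_fiber _), Finset.sum_mul]
    rw [Finset.sum_comm]
    refine Finset.sum_congr rfl fun i _ => Finset.sum_congr rfl fun j _ => by ring
  have hlim : Filter.Tendsto (fun n => fun x => ∫ s, hsm.approxBounded 1 n s ∂M.P k x)
      Filter.atTop (nhds fun x => ∫ s, V s ∂M.P k x) := by
    refine tendsto_pi_nhds.2 fun x => ?_
    refine tendsto_integral_of_dominated_convergence (fun _ => 1)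
      (fun n => (SimpleFunc.measurable _).aestronglyMeasurable) (integrable_const _)
      (fun n => Filter.Eventually.of_forall fun s => hsm.norm_approxBounded_le zero_le_one n s)
      (Filter.Eventually.of_forall fun s => hsm.tendsto_approxBounded_of_norm_le (hb s))
  obtain ⟨w, hw⟩ := hclosed.mem_of_tendsto hlim (Filter.Eventually.of_forall fun n => hmem _)
  exact ⟨w, fun x => (congrFun hw x).symm⟩

end LinMDP

/-! ### Jensen's inequality and D-optimal design. -/

theorem MeasureTheory.sq_integral_le_integral_sq {α : Type*} [MeasurableSpace α] {μ : Measure α}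
    [IsProbabilityMeasure μ] {f : α → ℝ} (hf : Integrable f μ)
    (hf2 : Integrable (fun x => f x ^ 2) μ) : (∫ x, f x ∂μ) ^ 2 ≤ ∫ x, f x ^ 2 ∂μ := by
  set c := ∫ x, f x ∂μ with hc
  have h1 : 0 ≤ ∫ x, (f x - c) ^ 2 ∂μ := integral_nonneg fun x => sq_nonneg _
  have h2 : ∫ x, (f x - c) ^ 2 ∂μ = ∫ x, f x ^ 2 ∂μ - c ^ 2 := by
    have h3 : ∀ x, (f x - c) ^ 2 = f x ^ 2 - (2 * c) * f x + c ^ 2 := fun x => by ring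
    simp only [h3]
    have h4 : Integrable (fun x => f x ^ 2 - (2 * c) * f x) μ := hf2.sub (hf.const_mul _)
    rw [integral_add h4 (integrable_const _),
      integral_sub hf2 (hf.const_mul _), integral_const_mul, ← hc]
    simp
    ring
  linarith

/-- A `D`-optimal design: the mixture of positive semidefinite matrices that maximizes the
regularized determinant satisfies the Kiefer-Wolfowitz inequality. -/
theorem Matrix.exists_stdSimplex_mul_trace_le {n ι : Type*} [Fintype n] [DecidableEq n]
    [Fintype ι] [Nonempty ι] {Y : ι → Matrix n n ℝ} (hY : ∀ i, (Y i).PosSemidef) {T : ℝ}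
    (hT : 0 ≤ T) :
    ∃ p ∈ stdSimplex ℝ ι, ∀ i, T * ((1 + T • ∑ j, p j • Y j)⁻¹ * Y i).trace ≤ Fintype.card n := by
  classical
  let F : (ι → ℝ) → ℝ := fun p => (1 + T • ∑ j, p j • Y j).det
  have hF : Continuous F := by
    refine Continuous.matrix_det ?_
    fun_prop
  obtain ⟨p, hp, hmax⟩ := (isCompact_stdSimplex ℝ ι).exists_isMaxOn
    ⟨_, single_mem_stdSimplex ℝ (Classical.arbitrary ι)⟩ hF.continuousOn
  refine ⟨p, hp, fun i => ?_⟩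
  set X := T • ∑ j, p j • Y j with hXdef
  have hX : X.PosSemidef :=
    (Matrix.posSemidef_sum _ fun j _ => (hY j).smul (hp.1 j)).smul hT
  have hM := LinMDP.posDef_one_add hX
  -- Optimality of p along the segment to the vertex i of the simplex.
  have h1 : ((1 + X)⁻¹ * (T • Y i - X)).trace ≤ 0 := by
    refine Matrix.trace_inv_mul_nonpos_of_det_le hM.det_pos fun s hs => ?_
    have hq : (1 - s) • p + s • (Pi.single i 1 : ι → ℝ) ∈ stdSimplex ℝ ι :=
      convex_stdSimplex ℝ ι hp (single_mem_stdSimplex ℝ i) (by linarith [hs.2]) hs.1 (by ring)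
    have h2 : F _ ≤ F p := hmax hq
    have h3 : 1 + X + s • (T • Y i - X) =
        1 + T • ∑ j, ((1 - s) • p + s • (Pi.single i 1 : ι → ℝ)) j • Y j := by
      have h4 : ∑ j, ((1 - s) • p + s • (Pi.single i 1 : ι → ℝ)) j • Y j =
          (1 - s) • ∑ j, p j • Y j + s • Y i := by
        simp only [Pi.add_apply, Pi.smul_apply, smul_eq_mul, add_smul, mul_smul,
          Finset.sum_add_distrib, ← Finset.smul_sum]
        congr 2
        simp [Pi.single_apply, ite_smul]
      rw [h4, hXdef, smul_add, smul_sub, smul_comm T (1 - s), smul_comm T s, sub_smul, one_smul]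
      abel
    rw [h3]
    exact h2
  have h5 : ((1 + X)⁻¹ * X).trace ≤ Fintype.card n := by
    have h6 : (1 + X)⁻¹ * X = 1 - (1 + X)⁻¹ := by
      have h7 := Matrix.nonsing_inv_mul (1 + X) ((Matrix.isUnit_iff_isUnit_det _).1 hM.isUnit)
      rw [mul_add, mul_one] at h7
      exact eq_sub_of_add_eq' h7
    rw [h6, Matrix.trace_sub, Matrix.trace_one]
    linarith [hM.posSemidef.inv.trace_nonneg]
  rw [mul_sub, Matrix.trace_sub, mul_smul_comm, Matrix.trace_smul, smul_eq_mul] at h1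
  linarith

/-! ### Feature covariances and approximate value iteration. -/

namespace LinMDP

variable {S A : Type*} [MeasurableSpace S] [MeasurableSpace A] {d H : ℕ}
  {φ : S × A → EuclideanSpace ℝ (Fin d)} {ε : ℝ}

section Cov

variable (hφ : Measurable φ) (hφ1 : ∀ x, ‖φ x‖ ≤ 1) (ν : Measure (S × A)) [IsFiniteMeasure ν]
include hφ hφ1

theorem integrable_feature_mul (i j : Fin d) : Integrable (fun x => φ x i * φ x j) ν := by
  refine integrable_of_measurable_of_mem_Icc (a := -1) (b := 1) (by fun_prop) fun x => ?_
  have h : ∀ k, |φ x k| ≤ 1 := fun k => (PiLp.norm_apply_le (φ x) k).trans (hφ1 x)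
  rw [Set.mem_Icc, ← abs_le, abs_mul]
  exact mul_le_one₀ (h i) (abs_nonneg _) (h j)

theorem sum_mul_cov (B : Matrix (Fin d) (Fin d) ℝ) :
    ∑ i, ∑ j, B i j * cov φ ν i j = ∫ x, (φ x).ofLp ⬝ᵥ (B *ᵥ (φ x).ofLp) ∂ν := by
  have hi := integrable_feature_mul hφ hφ1 ν
  have h1 : ∀ x, (φ x).ofLp ⬝ᵥ (B *ᵥ (φ x).ofLp) = ∑ i, ∑ j, B i j * (φ x i * φ x j) := by
    intro x
    simp only [dotProduct, Matrix.mulVec, Finset.mul_sum]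
    exact Finset.sum_congr rfl fun i _ => Finset.sum_congr rfl fun j _ => by ring
  simp only [h1]
  refine Eq.symm ((integral_finsetSum _ fun i _ => integrable_finsetSum _ fun j _ =>
    (hi i j).const_mul _).trans (Finset.sum_congr rfl fun i _ => ?_))
  refine (integral_finsetSum _ fun j _ => (hi i j).const_mul _).trans
    (Finset.sum_congr rfl fun j _ => ?_)
  exact integral_const_mul _ _

theorem dotProduct_cov_mulVec (v : Fin d → ℝ) :
    v ⬝ᵥ (cov φ ν *ᵥ v) = ∫ x, (v ⬝ᵥ (φ x).ofLp) ^ 2 ∂ν := by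
  have h := sum_mul_cov hφ hφ1 ν (Matrix.vecMulVec v v)
  have h1 : v ⬝ᵥ (cov φ ν *ᵥ v) = ∑ i, ∑ j, Matrix.vecMulVec v v i j * cov φ ν i j := by
    simp only [dotProduct, Matrix.mulVec, Finset.mul_sum, Matrix.vecMulVec_apply]
    exact Finset.sum_congr rfl fun i _ => Finset.sum_congr rfl fun j _ => by ring
  rw [h1, h]
  refine integral_congr_ae (Filter.Eventually.of_forall fun x => ?_)
  simp [Matrix.vecMulVec_mulVec, dotProduct_comm, sq]

omit hφ hφ1 [IsFiniteMeasure ν] in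
theorem isHermitian_cov : (cov φ ν).IsHermitian := by
  ext i j
  simp [cov, mul_comm]

theorem posSemidef_cov : (cov φ ν).PosSemidef := by
  refine Matrix.PosSemidef.of_dotProduct_mulVec_nonneg (isHermitian_cov ν) fun v => ?_
  rw [star_trivial, dotProduct_cov_mulVec hφ hφ1]
  exact integral_nonneg fun x => sq_nonneg _

theorem trace_mul_cov (B : Matrix (Fin d) (Fin d) ℝ) :
    (B * cov φ ν).trace = ∫ x, (φ x).ofLp ⬝ᵥ (B *ᵥ (φ x).ofLp) ∂ν := by
  rw [← sum_mul_cov hφ hφ1]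
  have h : ∀ i j, cov φ ν i j = cov φ ν j i := fun i j => by simp [cov, mul_comm]
  simp only [Matrix.trace, Matrix.diag, Matrix.mul_apply]
  exact Finset.sum_congr rfl fun i _ => Finset.sum_congr rfl fun j _ => by rw [h]

end Cov

/-- The least eigenvalue is below every diagonal entry, and the trace is the mean of ‖φ‖² ≤ 1. This
later keeps log(1/λ) away from 0. -/
theorem card_mul_lambdaMin_cov_le (hφ : Measurable φ) (hφ1 : ∀ x, ‖φ x‖ ≤ 1)
    (ν : Measure (S × A)) [IsProbabilityMeasure ν] : d * lambdaMin (cov φ ν) ≤ 1 := by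
  have h1 : ∀ i, lambdaMin (cov φ ν) ≤ cov φ ν i i := fun i => by
    have := (isHermitian_cov (φ := φ) ν).sInf_spectrum_mul_le (Pi.single i 1)
    simpa [lambdaMin, Matrix.mulVec_single] using this
  have h2 : (cov φ ν).trace ≤ 1 := by
    have h := trace_mul_cov hφ hφ1 ν 1
    rw [one_mul] at h
    rw [h]
    refine (integral_mono_of_nonneg (g := fun _ => 1) (Filter.Eventually.of_forall fun x => ?_)
      (integrable_const _) (Filter.Eventually.of_forall fun x => ?_)).trans (by simp)
    · simp only [Matrix.one_mulVec, dotProduct_self_eq_norm_sq]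
      exact sq_nonneg _
    · simp only [Matrix.one_mulVec, dotProduct_self_eq_norm_sq]
      exact pow_le_one₀ (norm_nonneg _) (hφ1 x)
  have h3 := Finset.sum_le_sum fun i (_ : i ∈ Finset.univ) => h1 i
  simp only [Finset.sum_const, Finset.card_univ, Fintype.card_fin, nsmul_eq_mul] at h3
  exact h3.trans h2

theorem ExpConstruction.cov_mixOcc (hφ : Measurable φ) (hφ1 : ∀ x, ‖φ x‖ ≤ 1)
    (C : ExpConstruction φ H ε) (M : LinearMDP φ H) (p : PMF C.policies) (h : Fin H) :
    cov φ (C.mixOcc M p h) =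
      ∑ f, (p f).toReal • cov φ (occ M (Policy.ofRules f.1) h) := by
  ext i j
  simp only [cov, mixOcc, Matrix.of_apply, Matrix.sum_apply, Matrix.smul_apply]
  rw [integral_finsetSum_measure fun f _ =>
    (integrable_feature_mul hφ hφ1 _ i j).smul_measure (p.apply_ne_top f)]
  simp only [integral_smul_measure]

/-- One step of value iteration with a decision rule from the explorative set. -/
theorem ExpConstruction.exists_previous_layer (hφ : Measurable φ) (hφ1 : ∀ x, ‖φ x‖ ≤ 1)
    (hd : 0 < d) (hH : 0 < H) (C : ExpConstruction φ H ε) (M : LinearMDP φ H) (k : Fin H)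
    (g : LayerValue S A) :
    ∃ (g' : LayerValue S A) (w : EuclideanSpace ℝ (Fin d)), g'.rule ∈ C.layer k ∧
      (∀ x, g'.q x = ∫ s, g.V s ∂M.P k x) ∧ (∀ x, g'.q x = inner ℝ (φ x) w) ∧
      ∀ s a, g'.q (s, a) ≤ g'.V s + ε / H * max 1 (‖w‖ / (2 * H * √(d : ℝ))) := by
  have hd' : (0 : ℝ) < d := by exact_mod_cast hd
  have hH' : (0 : ℝ) < H := by exact_mod_cast hH
  obtain ⟨w, hw⟩ := exists_integral_eq_inner M k g.measurable_V g.V_mem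
  set ρ := 2 * H * √(d : ℝ) with hρ
  have hρ0 : 0 < ρ := by positivity
  -- Dividing by κ brings w into the covered ball. Positive scaling preserves the argmax, so a rule
  -- greedy for u is nearly greedy for w, with error κε/(2H) paid twice.
  set κ := max 1 (‖w‖ / ρ) with hκ
  have hκ0 : 0 < κ := lt_of_lt_of_le one_pos (le_max_left _ _)
  obtain ⟨u, huW, hu⟩ := C.W_cover (κ⁻¹ • w) (by
    rw [norm_smul, Real.norm_of_nonneg (by positivity), inv_mul_le_iff₀ hκ0, ← div_le_iff₀ hρ0]
    exact le_max_right _ _)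
  have hclose : ∀ x, |inner ℝ (φ x) w - κ * inner ℝ (φ x) u| ≤ κ * (ε / (2 * H)) := fun x => by
    have h1 : inner ℝ (φ x) w - κ * inner ℝ (φ x) u = κ * inner ℝ (φ x) (κ⁻¹ • w - u) := by
      rw [inner_sub_right, inner_smul_right]
      field_simp
    rw [h1, abs_mul, abs_of_pos hκ0]
    gcongr
    refine (abs_real_inner_le_norm _ _).trans ?_
    exact (mul_le_of_le_one_left (norm_nonneg _) (hφ1 x)).trans hu
  refine ⟨{
    q := fun x => inner ℝ (φ x) w
    rule := C.ruleW k u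
    measurable_q := by fun_prop
    q_mem := fun x => ?_ }, w, ?_, fun x => (hw x).symm, fun x => rfl, fun s a => ?_⟩
  · rw [← hw]
    have hi : Integrable g.V (M.P k x) :=
      integrable_of_measurable_of_mem_Icc g.measurable_V g.V_mem
    refine ⟨integral_nonneg fun s => (g.V_mem s).1, ?_⟩
    refine (integral_mono hi (integrable_const 1) fun s => (g.V_mem s).2).trans (by simp)
  · classical
    exact Finset.mem_union_right _ (Finset.mem_image_of_mem _ huW)
  · have h1 := (abs_le.1 (hclose (s, a))).2
    have h2 := (abs_le.1 (hclose (s, (C.ruleW k u).1 s))).1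
    have h3 := mul_le_mul_of_nonneg_left (C.ruleW_greedy k u huW s a) hκ0.le
    simp only [linFun] at h3
    simp only [LayerValue.V]
    have h4 : ε / H * κ = κ * (ε / (2 * H)) + κ * (ε / (2 * H)) := by
      field_simp
      ring
    rw [h4]
    linarith

theorem ExpConstruction.exists_reward_layer (hφ : Measurable φ) (hφ1 : ∀ x, ‖φ x‖ ≤ 1)
    (C : ExpConstruction φ H ε) (h : Fin H) {X : Matrix (Fin d) (Fin d) ℝ}
    (hX : X.PosSemidef) :
    ∃ g : LayerValue S A, g.q = explReward φ X ∧ g.rule ∈ C.layer h ∧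
      ∀ s a, g.q (s, a) ≤ g.V s + ε / H := by
  obtain ⟨r, hr, hrX⟩ := C.R_cover X hX
  refine ⟨⟨explReward φ X, C.ruleR h r, measurable_explReward hφ X,
    fun x => ⟨explReward_nonneg X x, explReward_le_one hφ1 hX x⟩⟩, rfl, ?_, fun s a => ?_⟩
  · classical
    exact Finset.mem_union_left _ (Finset.mem_image_of_mem _ hr)
  · have h1 := (abs_le.1 (hrX (s, a))).2
    have h2 := (abs_le.1 (hrX (s, (C.ruleR h r).1 s))).1
    have h3 := C.ruleR_greedy h r hr s a
    simp only [LayerValue.V]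
    have h4 : ε / H = ε / (2 * H) + ε / (2 * H) := by
      rw [← two_mul, mul_div_mul_left _ _ two_ne_zero |>.symm, mul_div_assoc]
    rw [h4]
    linarith

/-- Approximate value iteration for the reward `explReward φ X` at layer `h`, with rules from the
explorative set. -/
theorem ExpConstruction.exists_greedy_chain (hφ : Measurable φ) (hφ1 : ∀ x, ‖φ x‖ ≤ 1)
    (hd : 0 < d) (hH : 0 < H) (C : ExpConstruction φ H ε) (M : LinearMDP φ H) (h : Fin H)
    {X : Matrix (Fin d) (Fin d) ℝ} (hX : X.PosSemidef) :
    ∃ (D : ℕ → LayerValue S A) (w : ℕ → EuclideanSpace ℝ (Fin d)),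
      (D h).q = explReward φ X ∧ (∀ s a, (D h).q (s, a) ≤ (D h).V s + ε / H) ∧
      (∀ k : Fin H, k ≤ h → (D k).rule ∈ C.layer k) ∧
      ∀ k (hk : k < h.1),
        (∀ x, (D k).q x = ∫ s, (D (k + 1)).V s ∂M.P ⟨k, hk.trans h.2⟩ x) ∧
        (∀ x, (D k).q x = inner ℝ (φ x) (w k)) ∧
        ∀ s a, (D k).q (s, a) ≤
          (D k).V s + ε / H * max 1 (‖w k‖ / (2 * H * √(d : ℝ))) := by
  obtain ⟨g, hgq, hgl, hgV⟩ := C.exists_reward_layer hφ hφ1 h hX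
  choose F W hFl hFP hFw hFV using C.exists_previous_layer hφ hφ1 hd hH M
  have hlt : ∀ n, h.1 - 1 - n < H := fun n => by omega
  -- Time runs backwards: `U n` serves layer h - n, and truncated subtraction keeps every layer
  -- index valid.
  let U : ℕ → LayerValue S A := fun n => Nat.rec g (fun n g' => F ⟨h.1 - 1 - n, hlt n⟩ g') n
  have hU : ∀ k (hk : k < h.1),
      U (h.1 - k) = F ⟨k, hk.trans h.2⟩ (U (h.1 - (k + 1))) := fun k hk => by
    have e : h.1 - k = (h.1 - (k + 1)) + 1 := by omega
    rw [e]
    change F _ _ = _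
    congr 2
    omega
  refine ⟨fun k => U (h.1 - k),
    fun k => if hk : k < H then W ⟨k, hk⟩ (U (h.1 - (k + 1))) else 0, ?_, ?_, ?_, ?_⟩
  · simpa [U] using hgq
  · simpa [U] using hgV
  · intro k hk
    rcases hk.lt_or_eq with hk | rfl
    · simp only [hU k hk]
      exact hFl _ _
    · simpa [U] using hgl
  · intro k hk
    simp only [hU k hk, dif_pos (hk.trans h.2)]
    exact ⟨hFP _ _, hFw _ _, hFV _ _⟩

end LinMDP

/-! ### Excitation, the self-bounding inequality and the explorative mixture. -/

namespace LinMDP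

variable {S A : Type*} [MeasurableSpace S] [MeasurableSpace A] {d H : ℕ}
  {φ : S × A → EuclideanSpace ℝ (Fin d)} {ε : ℝ}

/-- Excitation of a direction: a bound on its second moment under all policies is at least `lam`
times its squared length. -/
theorem mul_dotProduct_self_le_of_forall_policy (hφ : Measurable φ) (hφ1 : ∀ x, ‖φ x‖ ≤ 1)
    {M : LinearMDP φ H} {lam : ℝ} (hlam : 0 < lam) {h : Fin H}
    (hsup : lam ≤ ⨆ π : Policy S A H, lambdaMin (cov φ (occ M π h))) {v : Fin d → ℝ} {B : ℝ}
    (hB : ∀ π, ∫ x, (v ⬝ᵥ (φ x).ofLp) ^ 2 ∂occ M π h ≤ B) : lam * (v ⬝ᵥ v) ≤ B := by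
  -- Over an empty type the real supremum is 0, which `hlam` excludes.
  have : Nonempty (Policy S A H) := by
    by_contra hne
    rw [not_nonempty_iff] at hne
    rw [Real.iSup_of_isEmpty] at hsup
    linarith
  have hv : 0 ≤ v ⬝ᵥ v := by simpa using dotProduct_star_self_nonneg v
  by_contra! hcon
  have hv0 : 0 < v ⬝ᵥ v := by
    refine hv.lt_of_ne fun h0 => ?_
    obtain ⟨π⟩ := this
    rw [← h0, mul_zero] at hcon
    exact absurd ((integral_nonneg fun x => sq_nonneg _).trans (hB π)) (not_le.2 hcon)
  obtain ⟨π, hπ⟩ := exists_lt_of_lt_ciSup (((div_lt_iff₀ hv0).2 hcon).trans_le hsup)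
  have h1 := (isHermitian_cov (φ := φ) (occ M π h)).sInf_spectrum_mul_le v
  rw [dotProduct_cov_mulVec hφ hφ1] at h1
  have h2 := h1.trans (hB π)
  rw [div_lt_iff₀ hv0] at hπ
  exact absurd h2 (not_le.2 hπ)

theorem two_mul_le_one_of_le_iSup (hφ : Measurable φ) (hφ1 : ∀ x, ‖φ x‖ ≤ 1) (hd : 2 ≤ d)
    {M : LinearMDP φ H} {lam : ℝ} (hlam : 0 < lam) {h : Fin H}
    (hsup : lam ≤ ⨆ π : Policy S A H, lambdaMin (cov φ (occ M π h))) : 2 * lam ≤ 1 := by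
  have hd2 : (2 : ℝ) ≤ d := by exact_mod_cast hd
  have h1 : ⨆ π : Policy S A H, lambdaMin (cov φ (occ M π h)) ≤ 1 / d := by
    refine Real.iSup_le (fun π => ?_) (by positivity)
    rw [le_div_iff₀' (by linarith)]
    exact card_mul_lambdaMin_cov_le hφ hφ1 _
  have h2 := hsup.trans h1
  rw [le_div_iff₀ (by linarith)] at h2
  nlinarith

/-- If no rule profile of the explorative set collects much of the reward `explReward φ X`, then
`X` is large in every direction. -/
theorem ExpConstruction.one_le_dotProduct_mulVec (hφ : Measurable φ) (hφ1 : ∀ x, ‖φ x‖ ≤ 1)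
    (hd : 2 ≤ d) (hH : 1 ≤ H) (hε : 0 < ε) (C : ExpConstruction φ H ε) (M : LinearMDP φ H)
    {lam : ℝ} (hlam : 0 < lam)
    (hsup : ∀ h : Fin H, lam ≤ ⨆ π : Policy S A H, lambdaMin (cov φ (occ M π h)))
    (hεlam : ε ≤ lam / 4) (h : Fin H) {X : Matrix (Fin d) (Fin d) ℝ} (hX : X.PosSemidef)
    (hval : ∀ f ∈ C.policies, ∫ x, explReward φ X x ∂occ M (Policy.ofRules f) h ≤ lam / 6)
    {v : Fin d → ℝ} (hv : v ⬝ᵥ v = 1) : 1 ≤ v ⬝ᵥ (X *ᵥ v) := by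
  classical
  by_contra! hcon
  have hd2 : (2 : ℝ) ≤ d := by exact_mod_cast hd
  have hH1 : (1 : ℝ) ≤ H := by exact_mod_cast hH
  obtain ⟨D, w, hq, hDh, hrule, hstep⟩ :=
    C.exists_greedy_chain hφ hφ1 (by omega) (by omega) M h hX
  let l : ℕ → ℝ := fun k => ε / H * if k < h.1 then max 1 (‖w k‖ / (2 * H * √(d : ℝ))) else 1
  have hl : ∀ k ≤ h.1, ∀ s a, (D k).q (s, a) ≤ (D k).V s + l k := by
    intro k hk s a
    rcases hk.lt_or_eq with hk | rfl
    · simpa only [l, if_pos hk] using (hstep k hk).2.2 s a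
    · simpa [l] using hDh s a
  have hP := fun k (hk : k < h.1) => (hstep k hk).1
  have hl0 : ∀ k, 0 ≤ l k := fun k => by
    simp only [l]
    split_ifs <;> positivity
  set G := (D 0).V M.init + ∑ j ∈ Finset.range (h.1 + 1), l j with hG
  have hbound : ∀ (π : Policy S A H) (k : ℕ) (hk : k ≤ h.1),
      ∫ x, (D k).q x ∂occ M π ⟨k, hk.trans_lt h.2⟩ ≤ G := fun π k hk => by
    refine (integral_occ_le_of_chain hP hl π hk).trans ?_
    rw [hG]
    gcongr
  have hGlow : 2 / 3 * lam ≤ G := by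
    have h1 := mul_dotProduct_self_le_of_forall_policy hφ hφ1 hlam (hsup h) (v := v)
      (B := 3 / 2 * G) fun π => by
        have h2 : ∀ x, (v ⬝ᵥ (φ x).ofLp) ^ 2 ≤ 3 / 2 * (D h).q x := fun x => by
          rw [hq]
          exact sq_dotProduct_le_explReward hφ1 hX hv hcon.le x
        have hi : Integrable (D h).q (occ M π h) :=
          integrable_of_measurable_of_mem_Icc (D h).measurable_q (D h).q_mem
        refine (integral_mono_of_nonneg (Filter.Eventually.of_forall fun x => sq_nonneg _)
          (hi.const_mul (3 / 2)) (Filter.Eventually.of_forall h2)).trans ?_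
        rw [integral_const_mul]
        have := hbound π h le_rfl
        gcongr
    rw [hv] at h1
    linarith
  have hnorm : ∀ k < h.1, ‖w k‖ / (2 * H * √(d : ℝ)) ≤ √(G / (8 * lam)) := by
    intro k hk
    have h1 := mul_dotProduct_self_le_of_forall_policy hφ hφ1 hlam (hsup ⟨k, hk.trans h.2⟩)
      (v := (w k).ofLp) (B := G) fun π => by
        have h2 : ∀ x, ((w k).ofLp ⬝ᵥ (φ x).ofLp) ^ 2 ≤ (D k).q x := fun x => by
          have h3 : (w k).ofLp ⬝ᵥ (φ x).ofLp = (D k).q x := by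
            rw [(hstep k hk).2.1 x]
            simp [dotProduct, PiLp.inner_apply]
          rw [h3]
          have h4 := (D k).q_mem x
          nlinarith [h4.1, h4.2]
        have hi : Integrable (D k).q (occ M π ⟨k, hk.trans h.2⟩) :=
          integrable_of_measurable_of_mem_Icc (D k).measurable_q (D k).q_mem
        exact (integral_mono_of_nonneg (Filter.Eventually.of_forall fun x => sq_nonneg _)
          hi (Filter.Eventually.of_forall h2)).trans (hbound π k hk.le)
    rw [dotProduct_self_eq_norm_sq] at h1
    refine Real.le_sqrt_of_sq_le ?_
    rw [div_pow, mul_pow, mul_pow, Real.sq_sqrt (by positivity)]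
    rw [div_le_div_iff₀ (by positivity) (by positivity)]
    -- The squared ball radius 4H²d is at least 8 because d ≥ 2; this is the 8 in G/(8λ).
    have h5 : 8 ≤ 2 ^ 2 * (H : ℝ) ^ 2 * d := by nlinarith
    have h6 : 0 ≤ G := by linarith
    nlinarith
  set B := max 1 (√(G / (8 * lam))) with hB
  have hsum : ∑ j ∈ Finset.range (h.1 + 1), l j ≤ lam / 4 * B := by
    have h1 : ∀ j ∈ Finset.range (h.1 + 1), l j ≤ ε / H * B := fun j _ => by
      simp only [l]
      gcongr
      split_ifs with hj
      · exact max_le_max le_rfl (hnorm j hj)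
      · exact le_max_left _ _
    refine (Finset.sum_le_card_nsmul _ _ _ h1).trans ?_
    rw [Finset.card_range, nsmul_eq_mul]
    have h2 : ((h.1 + 1 : ℕ) : ℝ) ≤ H := by exact_mod_cast h.2
    have hB0 : 0 ≤ B := zero_le_one.trans (le_max_left _ _)
    calc ((h.1 + 1 : ℕ) : ℝ) * (ε / H * B) ≤ H * (ε / H * B) := by gcongr
      _ = ε * B := by field_simp
      _ ≤ _ := by gcongr
  have hV0 : (D 0).V M.init ≤ lam / 6 := by
    obtain ⟨w0, hw0, -⟩ := C.W_cover 0 (by simp; positivity)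
    -- Layers after h do not affect the law at h, so any explorative rule may fill them.
    let f : Fin H → DetRule S A := fun k => if k ≤ h then (D k).rule else C.ruleW k w0
    have hfC : f ∈ C.policies := by
      refine Fintype.mem_piFinset.2 fun k => ?_
      simp only [f]
      split_ifs with hk
      · exact hrule k hk
      · exact Finset.mem_union_right _ (Finset.mem_image_of_mem _ hw0)
    have h1 := integral_occ_ofRules_of_chain hP (f := f) (fun k hk => by simp only [f, if_pos hk])
      le_rfl
    rw [← h1, hq]
    exact hval f hfC
  have hGB : G ≤ lam / 6 + lam / 4 * B := by rw [hG]; linarith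
  have hy : √(G / (8 * lam)) ≤ max 1 (G / (8 * lam)) := by
    rcases le_total (G / (8 * lam)) 1 with h1 | h1
    · exact (Real.sqrt_le_one.2 h1).trans (le_max_left _ _)
    · exact (Real.sqrt_le_iff.2 ⟨by positivity, by nlinarith⟩).trans (le_max_right _ _)
  have hB2 : B ≤ max 1 (G / (8 * lam)) := max_le (le_max_left _ _) hy
  -- The two cases give G ≤ 5λ/12 and G ≤ λ/6 + G/32, both contradicting G ≥ 2λ/3.
  rcases max_cases 1 (G / (8 * lam)) with ⟨h1, -⟩ | ⟨h1, -⟩ <;> rw [h1] at hB2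
  · nlinarith
  · have h2 : lam / 4 * (G / (8 * lam)) = G / 32 := by
      field_simp
      ring
    have h3 : lam / 4 * B ≤ G / 32 := by
      rw [← h2]
      gcongr
    linarith

theorem ExpConstruction.exists_mixture (hφ : Measurable φ) (hφ1 : ∀ x, ‖φ x‖ ≤ 1)
    (hd : 2 ≤ d) (hH : 1 ≤ H) (hε : 0 < ε) (C : ExpConstruction φ H ε) (M : LinearMDP φ H)
    {lam : ℝ}
    (hsup : ∀ h : Fin H, lam ≤ ⨆ π : Policy S A H, lambdaMin (cov φ (occ M π h)))
    (hεlam : ε ≤ lam / 4) (h : Fin H) :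
    ∃ p : PMF C.policies, lam ^ 2 / (64 * d * Real.log (1 / lam)) ≤
      lambdaMin (cov φ (C.mixOcc M p h)) := by
  classical
  have hlam : 0 < lam := by linarith
  have hd2 : (2 : ℝ) ≤ d := by exact_mod_cast hd
  have : Nonempty (Fin d) := ⟨⟨0, by omega⟩⟩
  -- Since λ ≤ 1/2, the logarithm is at least log 2 > 9/16. As 64 · 9/16 = 36, the design bound
  -- λ²/(64 L) on the mean of r² is at most (λ/6)².
  have hL : 9 / 16 ≤ Real.log (1 / lam) := by
    have h1 := two_mul_le_one_of_le_iSup hφ hφ1 hd hlam (hsup h)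
    have h2 : (2 : ℝ) ≤ 1 / lam := by rwa [le_div_iff₀ hlam]
    have := Real.log_le_log two_pos h2
    linarith [Real.log_two_gt_d9]
  set L := Real.log (1 / lam)
  set T := 64 * d * L / lam ^ 2 with hT
  have hT0 : 0 < T := by positivity
  have : Nonempty C.policies := by
    obtain ⟨w0, hw0, -⟩ := C.W_cover 0 (by simp; positivity)
    exact ⟨⟨fun k => C.ruleW k w0, Fintype.mem_piFinset.2 fun k =>
      Finset.mem_union_right _ (Finset.mem_image_of_mem _ hw0)⟩⟩
  let Y : C.policies → Matrix (Fin d) (Fin d) ℝ := fun f => cov φ (occ M (Policy.ofRules f.1) h)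
  have hY : ∀ f, (Y f).PosSemidef := fun f => posSemidef_cov hφ hφ1 _
  obtain ⟨p, hp, htr⟩ := Matrix.exists_stdSimplex_mul_trace_le hY hT0.le
  set Z := ∑ f, p f • Y f with hZ
  have hX : (T • Z).PosSemidef :=
    (Matrix.posSemidef_sum _ fun j _ => (hY j).smul (hp.1 j)).smul hT0.le
  let P : PMF C.policies := PMF.ofFintype (fun f => ENNReal.ofReal (p f)) (by
    rw [← ENNReal.ofReal_sum_of_nonneg fun f _ => hp.1 f, hp.2, ENNReal.ofReal_one])
  have hcov : cov φ (C.mixOcc M P h) = Z := by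
    rw [C.cov_mixOcc hφ hφ1]
    refine Finset.sum_congr rfl fun f _ => ?_
    simp only [P, PMF.ofFintype_apply, ENNReal.toReal_ofReal (hp.1 f), Y]
  refine ⟨P, ?_⟩
  rw [hcov]
  have hZh : Z.IsHermitian := (Matrix.posSemidef_sum _ fun j _ => (hY j).smul (hp.1 j)).isHermitian
  refine hZh.le_sInf_spectrum fun v hv => ?_
  have hval : ∀ f ∈ C.policies,
      ∫ x, explReward φ (T • Z) x ∂occ M (Policy.ofRules f) h ≤ lam / 6 := by
    intro f hf
    have hm := measurable_explReward hφ (T • Z)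
    have hr : ∀ x, explReward φ (T • Z) x ∈ Set.Icc (0 : ℝ) 1 := fun x =>
      ⟨explReward_nonneg _ x, explReward_le_one hφ1 hX x⟩
    have h1 := sq_integral_le_integral_sq (μ := occ M (Policy.ofRules f) h)
      (integrable_of_measurable_of_mem_Icc hm hr)
      (integrable_of_measurable_of_mem_Icc (hm.pow_const 2) (a := 0) (b := 1)
        fun x => ⟨sq_nonneg _, pow_le_one₀ (hr x).1 (hr x).2⟩)
    simp only [sq_explReward hX] at h1
    rw [← trace_mul_cov hφ hφ1] at h1
    have h2 := htr ⟨f, hf⟩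
    rw [Fintype.card_fin] at h2
    have h3 := (mul_le_mul_of_nonneg_left h1 hT0.le).trans h2
    refine le_of_sq_le_sq ?_ (by positivity)
    set I := ∫ x, explReward φ (T • Z) x ∂occ M (Policy.ofRules f) h
    have h4 : T * I ^ 2 = d * (64 * L * I ^ 2 / lam ^ 2) := by
      rw [hT]
      ring
    rw [h4, mul_le_iff_le_one_right (by linarith), div_le_one (by positivity)] at h3
    nlinarith [mul_le_mul_of_nonneg_right hL (sq_nonneg I)]
  have h5 := C.one_le_dotProduct_mulVec hφ hφ1 hd hH hε M hlam hsup hεlam h hX hval hv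
  rw [Matrix.smul_mulVec, dotProduct_smul, smul_eq_mul] at h5
  have h6 : lam ^ 2 / (64 * d * L) = 1 / T := by rw [hT, one_div_div]
  rw [h6, div_le_iff₀' hT0]
  exact h5

end LinMDP

end

theorem lemmaC8 {S A : Type*} [MeasurableSpace S] [MeasurableSpace A] {d H : ℕ}
    (hd : 2 ≤ d) (hH : 1 ≤ H)
    (φ : S × A → EuclideanSpace ℝ (Fin d)) (hφ : Measurable φ) (hφ1 : ∀ x, ‖φ x‖ ≤ 1)
    (ε : ℝ) (hε : 0 < ε) :
    -- every construction yields a set with explorative mixtures, for all linear MDPs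
    (∀ (C : LinMDP.ExpConstruction φ H ε) (M : LinMDP.LinearMDP φ H) (lam : ℝ),
      (∀ h : Fin H,
        lam ≤ ⨆ π : LinMDP.Policy S A H, LinMDP.lambdaMin (LinMDP.cov φ (LinMDP.occ M π h))) →
      ε ≤ lam / 4 →
      ∀ h : Fin H, ∃ p : PMF C.policies,
        lam ^ 2 / (64 * d * Real.log (1 / lam)) ≤
          LinMDP.lambdaMin (LinMDP.cov φ (C.mixOcc M p h))) ∧
    -- size of the layer sets
    (ε ≤ 1 → ∀ C : LinMDP.ExpConstruction φ H ε, C.IsSmall → ∀ h : Fin H,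
      Real.log (C.layer h).card ≤
        2 * d ^ 2 * Real.log (1 + 32 * H ^ 2 * √(d : ℝ) / ε ^ 2)) ∧
    -- the construction can be carried out whenever the `argmax` rules exist
    ((∀ w, ∃ f : LinMDP.DetRule S A, LinMDP.IsGreedy (LinMDP.linFun φ w) f) →
      (∀ X : Matrix (Fin d) (Fin d) ℝ, X.PosSemidef →
        ∃ f : LinMDP.DetRule S A, LinMDP.IsGreedy (LinMDP.explReward φ X) f) →
      ∃ C : LinMDP.ExpConstruction φ H ε, C.IsSmall) := by
  refine ⟨fun C M lam hsup hεlam h => ?_, fun hε1 C hC h => ?_, fun hw hr => ?_⟩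
  · exact C.exists_mixture hφ hφ1 hd hH hε M hsup hεlam h
  · exact hC.log_card_layer_le hd hH hε hε1 h
  · exact LinMDP.exists_isSmall hH hφ1 hε hw hr
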